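/- Let $G$ be a compact Lie group with Lie algebra $\mathfrak g$ (identified with $T_eG$ and with the left-invariant vector fields on $G$). Let $J\subseteq\mathbb R$ be a non-degenerate interval containing $0$, and let $(h_t)_{t\in J}$ be a path of left-invariant Riemannian metrics on $G$ such that $h_0$ is bi-invariant and $t\mapsto h_t(A,B)$ is of class $C^2$ at $t=0$ for all $A,B\in\mathfrak g$ (for instance, a smooth path). All derivatives in $t$ are taken within $J$ (hence one-sided if $0$ is an endpoint of $J$). Write $\langle A,B\rangle=h_0(A,B)$ and $|A|^2=h_0(A,A)$ for $A,B\in\mathfrak g$. Let $\Phi_t:\mathfrak g\to\mathfrak g$ be the endomorphism with $h_t(A,B)=\langle\Phi_tA,B\rangle$ for all $A,B\in\mathfrak g$, and let $\Psi=\frac{d}{dt}\big|_{t=0}\Phi_t$. Let $X,Y\in\mathfrak g$ with $[X,Y]=0$, and let $k(t)=h_t(R^t(X,Y)Y,X)$ be the unnormalized sectional curvature of $X$ and $Y$ with respect to $h_t$, where $R^t(X,Y)Z=\nabla^t_X\nabla^t_YZ-\nabla^t_Y\nabla^t_XZ-\nabla^t_{[X,Y]}Z$ is the curvature tensor of the Levi-Civita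 connection $\nabla^t$ of $h_t$. Then $k$ is of class $C^2$ at $t=0$, $k(0)=0$, $k'(0)=0$, and $$2k''(0)=\big|[X,\Psi Y]+[\Psi X,Y]\big|^2=\Big|\frac{d}{dt}\Big|_{t=0}[\Phi_tX,\Phi_tY]\Big|^2 .$$ In particular $k''(0)\ge 0$. -/

import Mathlib

open scoped Manifold ContDiff

noncomputable section

section Riemannian

open Bundle VectorField FiberBundle

variable {E : Type*} [NormedAddCommGroup E] [NormedSpace ℝ E]
  {H : Type*} [TopologicalSpace H] {I : ModelWithCorners ℝ E H}
  {M : Type*} [TopologicalSpace M] [ChartedSpace H M] [IsManifold I ∞ M]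

variable (I M) in
/-- Smooth Riemannian metrics on the manifold `M`. -/
abbrev SmoothMetric : Type _ :=
  ContMDiffRiemannianMetric I ∞ E (fun x : M ↦ TangentSpace I x)

variable (I M) in
/-- Affine connections on the manifold `M`; `cov Y x (X x)` is the value of `∇_X Y` at `x`. -/
abbrev AffineConnection : Type _ :=
  CovariantDerivative I E (fun x : M ↦ TangentSpace I x)

/-- `cov` is a Levi-Civita connection of `g`: it is torsion free, `∇_X Y - ∇_Y X = [X, Y]`, and
compatible with the metric, `v (g(Y, Z)) = g(∇_v Y, Z) + g(Y, ∇_v Z)`. -/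
structure IsLeviCivita (g : SmoothMetric I M) (cov : AffineConnection I M) : Prop where
  torsion_free : ∀ {X Y : Π x : M, TangentSpace I x} {x : M},
    MDiffAt (T% X) x → MDiffAt (T% Y) x →
      cov Y x (X x) - cov X x (Y x) = mlieBracket I X Y x
  metric : ∀ {Y Z : Π x : M, TangentSpace I x} {x : M} (v : TangentSpace I x),
    MDiffAt (T% Y) x → MDiffAt (T% Z) x →
      d% (fun y ↦ g.inner y (Y y) (Z y)) x v
        = g.inner x (cov Y x v) (Z x) + g.inner x (Y x) (cov Z x v)

theorem SmoothMetric.mdifferentiableAt_inner (g : SmoothMetric I M)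
    {Y Z : Π x : M, TangentSpace I x} {x : M}
    (hY : MDiffAt (T% Y) x) (hZ : MDiffAt (T% Z) x) :
    MDiffAt (fun y ↦ g.inner y (Y y) (Z y)) x := by
  let _ : RiemannianBundle (fun x : M ↦ TangentSpace I x) := ⟨g.toRiemannianMetric⟩
  have : IsContMDiffRiemannianBundle I 1 E (fun x : M ↦ TangentSpace I x) :=
    IsContMDiffRiemannianBundle.of_le (n := ∞) (by norm_cast)
  exact MDifferentiableAt.inner_bundle (E := fun x : M ↦ TangentSpace I x) hY hZ

theorem SmoothMetric.ext_inner (g : SmoothMetric I M) {x : M} {u v : TangentSpace I x}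
    (h : ∀ w, g.inner x u w = g.inner x v w) : u = v := by
  by_contra hne
  have h1 := g.pos x (u - v) (sub_ne_zero.2 hne)
  have h2 := h (u - v)
  simp only [map_sub, sub_apply] at h1 h2
  linarith

/-- The right-hand side of the Koszul formula for `2 g(∇_X Y, Z)` at the point `x`. -/
def koszul (g : SmoothMetric I M) (X Y Z : Π x : M, TangentSpace I x) (x : M) : ℝ :=
  d% (fun y ↦ g.inner y (Y y) (Z y)) x (X x) + d% (fun y ↦ g.inner y (X y) (Z y)) x (Y x)
    - d% (fun y ↦ g.inner y (X y) (Y y)) x (Z x)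
    + g.inner x (mlieBracket I X Y x) (Z x) - g.inner x (mlieBracket I X Z x) (Y x)
    - g.inner x (mlieBracket I Y Z x) (X x)

variable [FiniteDimensional ℝ E]

theorem tensorialAt_koszul_left (g : SmoothMetric I M) {Y Z : Π x : M, TangentSpace I x} {x : M}
    (hY : MDiffAt (T% Y) x) (hZ : MDiffAt (T% Z) x) :
    TensorialAt I E (fun X : Π x : M, TangentSpace I x ↦ koszul g X Y Z x) x := by
  have : CompleteSpace E := FiniteDimensional.complete ℝ E
  constructor
  · intro f X hf hX
    simp only [koszul, mlieBracket_smul_left hf hX]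
    simp [mvfderiv_fun_mul hf (g.mdifferentiableAt_inner hX hZ),
      mvfderiv_fun_mul hf (g.mdifferentiableAt_inner hX hY)]
    ring
  · intro X X' hX hX'
    simp only [koszul, mlieBracket_add_left hX hX']
    simp [mvfderiv_fun_add (g.mdifferentiableAt_inner hX hZ) (g.mdifferentiableAt_inner hX' hZ),
      mvfderiv_fun_add (g.mdifferentiableAt_inner hX hY) (g.mdifferentiableAt_inner hX' hY)]
    ring

theorem tensorialAt_koszul_right (g : SmoothMetric I M) {X Y : Π x : M, TangentSpace I x} {x : M}
    (hX : MDiffAt (T% X) x) (hY : MDiffAt (T% Y) x) :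
    TensorialAt I E (fun Z : Π x : M, TangentSpace I x ↦ koszul g X Y Z x) x := by
  have : CompleteSpace E := FiniteDimensional.complete ℝ E
  constructor
  · intro f Z hf hZ
    simp only [koszul, mlieBracket_smul_right hf hZ]
    simp [mvfderiv_fun_mul hf (g.mdifferentiableAt_inner hX hZ),
      mvfderiv_fun_mul hf (g.mdifferentiableAt_inner hY hZ)]
    rw [g.symm x (Z x) (X x), g.symm x (Z x) (Y x)]
    ring
  · intro Z Z' hZ hZ'
    simp only [koszul, mlieBracket_add_right hZ hZ']
    simp [mvfderiv_fun_add (g.mdifferentiableAt_inner hX hZ) (g.mdifferentiableAt_inner hX hZ'),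
      mvfderiv_fun_add (g.mdifferentiableAt_inner hY hZ) (g.mdifferentiableAt_inner hY hZ')]
    ring

theorem koszul_add_middle (g : SmoothMetric I M) {X Y Y' Z : Π x : M, TangentSpace I x} {x : M}
    (hX : MDiffAt (T% X) x) (hY : MDiffAt (T% Y) x) (hY' : MDiffAt (T% Y') x)
    (hZ : MDiffAt (T% Z) x) :
    koszul g X (Y + Y') Z x = koszul g X Y Z x + koszul g X Y' Z x := by
  have : CompleteSpace E := FiniteDimensional.complete ℝ E
  simp only [koszul, mlieBracket_add_right hY hY', mlieBracket_add_left hY hY']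
  simp [mvfderiv_fun_add (g.mdifferentiableAt_inner hY hZ) (g.mdifferentiableAt_inner hY' hZ),
    mvfderiv_fun_add (g.mdifferentiableAt_inner hX hY) (g.mdifferentiableAt_inner hX hY')]
  ring

theorem koszul_smul_middle (g : SmoothMetric I M) {X Y Z : Π x : M, TangentSpace I x} {f : M → ℝ}
    {x : M} (hf : MDiffAt f x) (hX : MDiffAt (T% X) x) (hY : MDiffAt (T% Y) x)
    (hZ : MDiffAt (T% Z) x) :
    koszul g X (f • Y) Z x
      = f x * koszul g X Y Z x + 2 * (d% f x (X x) * g.inner x (Y x) (Z x)) := by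
  have : CompleteSpace E := FiniteDimensional.complete ℝ E
  simp only [koszul, mlieBracket_smul_right hf hY, mlieBracket_smul_left hf hY]
  simp [mvfderiv_fun_mul hf (g.mdifferentiableAt_inner hY hZ),
    mvfderiv_fun_mul hf (g.mdifferentiableAt_inner hX hY)]
  rw [g.symm x (Y x) (X x)]
  ring

theorem exists_koszul (g : SmoothMetric I M) (Y : Π x : M, TangentSpace I x) (x : M) :
    ∃ L : TangentSpace I x →L[ℝ] TangentSpace I x, MDiffAt (T% Y) x →
      ∀ X Z : Π x : M, TangentSpace I x, MDiffAt (T% X) x → MDiffAt (T% Z) x →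
        2 * g.inner x (L (X x)) (Z x) = koszul g X Y Z x := by
  by_cases hY : MDiffAt (T% Y) x
  swap
  · exact ⟨0, fun h ↦ absurd h hY⟩
  have : FiniteDimensional ℝ (TangentSpace I x) := inferInstanceAs (FiniteDimensional ℝ E)
  have : T2Space (TangentSpace I x) := inferInstanceAs (T2Space E)
  let B := TensorialAt.mkHom₂ (I := I) (F := E) (F' := E) 
    (fun X Z : Π x : M, TangentSpace I x ↦ koszul g X Y Z x) x
    (fun Z hZ ↦ tensorialAt_koszul_left g hY hZ) (fun X hX ↦ tensorialAt_koszul_right g hX hY)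
  have hB : ∀ X Z : Π x : M, TangentSpace I x, MDiffAt (T% X) x → MDiffAt (T% Z) x →
      B (X x) (Z x) = koszul g X Y Z x := fun X Z hX hZ ↦
    TensorialAt.mkHom₂_apply (fun Z hZ ↦ tensorialAt_koszul_left g hY hZ)
      (fun X hX ↦ tensorialAt_koszul_right g hX hY) hX hZ
  let T : TangentSpace I x →ₗ[ℝ] Module.Dual ℝ (TangentSpace I x) :=
    ContinuousLinearMap.coeLM ℝ ∘ₗ (g.inner x).toLinearMap
  have hTinj : Function.Injective T := fun u v huv ↦
    SmoothMetric.ext_inner g fun w ↦ LinearMap.congr_fun huv w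
  have hTsurj : Function.Surjective T :=
    (LinearMap.injective_iff_surjective_of_finrank_eq_finrank
      (Subspace.dual_finrank_eq (K := ℝ) (V := TangentSpace I x)).symm).1 hTinj
  let e := LinearEquiv.ofBijective T ⟨hTinj, hTsurj⟩
  let L : TangentSpace I x →ₗ[ℝ] TangentSpace I x :=
    (1 / 2 : ℝ) • (e.symm.toLinearMap ∘ₗ ContinuousLinearMap.coeLM ℝ ∘ₗ B.toLinearMap)
  refine ⟨LinearMap.toContinuousLinearMap L, fun _ X Z hX hZ ↦ ?_⟩
  rw [← hB X Z hX hZ]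
  have h3 : g.inner x (e.symm (ContinuousLinearMap.coeLM ℝ (B (X x)))) (Z x) = B (X x) (Z x) :=
    LinearMap.congr_fun (e.apply_symm_apply (ContinuousLinearMap.coeLM ℝ (B (X x)))) (Z x)
  simp only [LinearMap.coe_toContinuousLinearMap', L, map_smul,
    smul_apply, LinearMap.comp_apply, smul_eq_mul]
  erw [h3]
  ring

/-- Every smooth Riemannian metric has a Levi-Civita connection. -/
theorem exists_isLeviCivita (g : SmoothMetric I M) :
    ∃ cov : AffineConnection I M, IsLeviCivita g cov := by
  have : CompleteSpace E := FiniteDimensional.complete ℝ E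
  choose c hc using exists_koszul g
  have key : ∀ {Y : Π x : M, TangentSpace I x} {x : M}, MDiffAt (T% Y) x →
      ∀ {X Z : Π x : M, TangentSpace I x}, MDiffAt (T% X) x → MDiffAt (T% Z) x →
        2 * g.inner x (c Y x (X x)) (Z x) = koszul g X Y Z x :=
    fun hY X Z hX hZ ↦ hc _ _ hY X Z hX hZ
  have hext : ∀ {x : M} (v : TangentSpace I x),
      MDiffAt (T% (extend E v : Π x : M, TangentSpace I x)) x :=
    fun v ↦ mdifferentiableAt_extend ..
  refine ⟨⟨c, ⟨?_, ?_⟩⟩, ⟨?_, ?_⟩⟩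
  · intro Y Y' x hY hY' _
    ext1 v
    refine SmoothMetric.ext_inner g fun w ↦ ?_
    have h1 := key (mdifferentiableAt_add_section hY hY') (hext v) (hext w)
    have h2 := key hY (hext v) (hext w)
    have h3 := key hY' (hext v) (hext w)
    have h4 := koszul_add_middle g (hext v) hY hY' (hext w)
    simp only [extend_apply_self, Pi.add_def, add_apply, map_add] at *
    linarith
  · intro Y f x hY hf _
    ext1 v
    refine SmoothMetric.ext_inner g fun w ↦ ?_
    have h1 := key (hf.smul_section hY) (hext v) (hext w)
    have h2 := key hY (hext v) (hext w)
    have h4 := koszul_smul_middle g hf (hext v) hY (hext w)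
    simp only [extend_apply_self] at h1 h2 h4
    simp
    linear_combination (1 / 2) * h1 + (1 / 2) * h4 - (f x / 2) * h2
  · intro X Y x hX hY
    refine SmoothMetric.ext_inner g fun w ↦ ?_
    have h1 := key hY hX (hext w)
    have h2 := key hX hY (hext w)
    simp only [koszul, extend_apply_self] at h1 h2
    simp only [map_sub, sub_apply]
    have h3 : mlieBracket I Y X x = - mlieBracket I X Y x := mlieBracket_swap_apply
    have h4 : (fun y ↦ g.inner y (Y y) (X y)) = fun y ↦ g.inner y (X y) (Y y) :=
      funext fun y ↦ g.symm y _ _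
    rw [h3, h4] at h2
    simp only [map_neg, neg_apply] at h2
    linarith
  · intro Y Z x v hY hZ
    have h1 := key hY (hext v) hZ
    have h2 := key hZ (hext v) hY
    simp only [koszul, extend_apply_self] at h1 h2
    have h3 : mlieBracket I Z Y x = - mlieBracket I Y Z x := mlieBracket_swap_apply
    have h4 : (fun y ↦ g.inner y (Z y) (Y y)) = fun y ↦ g.inner y (Y y) (Z y) :=
      funext fun y ↦ g.symm y _ _
    rw [h3, h4] at h2
    simp only [map_neg, neg_apply] at h2
    rw [g.symm x (Y x)]
    linarith

/-- The Levi-Civita connection of a smooth Riemannian metric. -/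
def leviCivita (g : SmoothMetric I M) : AffineConnection I M :=
  (exists_isLeviCivita g).choose

theorem isLeviCivita_leviCivita (g : SmoothMetric I M) : IsLeviCivita g (leviCivita g) :=
  (exists_isLeviCivita g).choose_spec

/-- The curvature `R(X, Y)Z = ∇_X ∇_Y Z - ∇_Y ∇_X Z - ∇_[X, Y] Z` of a connection. -/
def curvatureField (cov : AffineConnection I M) (X Y Z : Π x : M, TangentSpace I x) (x : M) :
    TangentSpace I x :=
  cov (fun y ↦ cov Z y (Y y)) x (X x) - cov (fun y ↦ cov Z y (X y)) x (Y x)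
    - cov Z x (mlieBracket I X Y x)

/-- The unnormalized sectional curvature `g(R(X, Y)Y, X)` of two vector fields at the point `x`. -/
def unnormalizedSectionalCurvature (g : SmoothMetric I M) (X Y : Π x : M, TangentSpace I x)
    (x : M) : ℝ :=
  g.inner x (curvatureField (leviCivita g) X Y Y x) (X x)

end Riemannian

section LieGroup

variable {E : Type*} [NormedAddCommGroup E] [NormedSpace ℝ E]
  {H : Type*} [TopologicalSpace H] {I : ModelWithCorners ℝ E H}
  {G : Type*} [TopologicalSpace G] [ChartedSpace H G] [Group G] [LieGroup I ∞ G]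

/-- The metric `h` is invariant under all left translations `x ↦ a * x`. -/
def IsLeftInvariant (h : SmoothMetric I G) : Prop :=
  ∀ (a x : G) (v w : TangentSpace I x),
    h.inner (a * x) (mfderiv I I (fun y ↦ a * y) x v) (mfderiv I I (fun y ↦ a * y) x w)
      = h.inner x v w

/-- The metric `h` is invariant under all right translations `x ↦ x * a`. -/
def IsRightInvariant (h : SmoothMetric I G) : Prop :=
  ∀ (a x : G) (v w : TangentSpace I x),
    h.inner (x * a) (mfderiv I I (fun y ↦ y * a) x v) (mfderiv I I (fun y ↦ y * a) x w)
      = h.inner x v w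

/-- The metric `h` is bi-invariant. -/
def IsBiInvariant (h : SmoothMetric I G) : Prop :=
  IsLeftInvariant h ∧ IsRightInvariant h

/-- The unnormalized sectional curvature, with respect to `h`, of two elements of the Lie algebra,
regarded as left-invariant vector fields and evaluated at the identity. -/
def lieSectionalCurvature [FiniteDimensional ℝ E] (h : SmoothMetric I G)
    (X Y : GroupLieAlgebra I G) : ℝ :=
  unnormalizedSectionalCurvature h (mulInvariantVectorField X) (mulInvariantVectorField Y) 1

end LieGroup

end

/-!
Write `Φ` for the endomorphism representing a left-invariant metric `h` in terms of a bi-invariant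
one `⟨·, ·⟩`. Since `ad` is skew for `⟨·, ·⟩`, the Koszul formula reads
`2 Φ (∇_X Y) = Φ [X, Y] + [X, Φ Y] + [Y, Φ X]`. For commuting `X`, `Y` the curvature is
`h(∇_X Y, ∇_X Y) - h(∇_X X, ∇_Y Y)`, that is,
`¼ ⟨s, Φ⁻¹ s⟩ - ⟨[X, Φ X], Φ⁻¹ [Y, Φ Y]⟩` with `s = [X, Φ Y] + [Y, Φ X]`.
At `t = 0` all three of `s`, `[X, Φ X]`, `[Y, Φ Y]` vanish, so both terms vanish to second order and
their second derivatives involve only `Ψ`. Finally `⟨[X, ΨX], [Y, ΨY]⟩ = ⟨[X, ΨY], [Y, ΨX]⟩`, by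
the Jacobi identity and the skewness of `ad`, turns `|[X, ΨY] + [Y, ΨX]|² - 4 ⟨[X, ΨX], [Y, ΨY]⟩`
into `|[X, ΨY] - [Y, ΨX]|²`.
-/

open scoped Topology

noncomputable section

section Calculus

variable {𝕜 : Type*} [NontriviallyNormedField 𝕜]
  {D : Type*} [NormedAddCommGroup D] [NormedSpace 𝕜 D]
  {E : Type*} [NormedAddCommGroup E] [NormedSpace 𝕜 E]
  {F : Type*} [NormedAddCommGroup F] [NormedSpace 𝕜 F]
  {F' : Type*} [NormedAddCommGroup F'] [NormedSpace 𝕜 F']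

theorem contDiffWithinAt_clm_apply_iff [CompleteSpace 𝕜] [FiniteDimensional 𝕜 E] {n : ℕ∞ω}
    {f : D → E →L[𝕜] F} {s : Set D} {x : D} :
    ContDiffWithinAt 𝕜 n f s x ↔ ∀ v, ContDiffWithinAt 𝕜 n (fun t ↦ f t v) s x := by
  refine ⟨fun hf v ↦ hf.clm_apply contDiffWithinAt_const, fun hf ↦ ?_⟩
  let e₁ : E ≃L[𝕜] Fin (Module.finrank 𝕜 E) → 𝕜 :=
    ContinuousLinearEquiv.ofFinrankEq (Module.finrank_fin_fun 𝕜).symm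
  let e₂ := (e₁.arrowCongr (1 : F ≃L[𝕜] F)).trans (ContinuousLinearEquiv.piRing _)
  rw [← Function.id_comp f, ← e₂.symm_comp_self]
  exact e₂.symm.contDiff.contDiffAt.comp_contDiffWithinAt x
    (contDiffWithinAt_pi.mpr fun i ↦ hf _)

theorem contDiffWithinAt_of_injective_comp {n : ℕ∞ω} [CompleteSpace 𝕜] [FiniteDimensional 𝕜 F]
    {L : E →L[𝕜] F} (hL : Function.Injective L) {f : D → E} {s : Set D}
    {x : D} (hf : ContDiffWithinAt 𝕜 n (fun t ↦ L (f t)) s x) : ContDiffWithinAt 𝕜 n f s x := by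
  obtain ⟨S, hS⟩ := ContinuousLinearMap.HasLeftInverse.of_injective_of_finiteDimensional hL
  simpa only [Function.comp_def, hS _] using S.contDiff.contDiffAt.comp_contDiffWithinAt x hf

theorem eventually_differentiableWithinAt_of_contDiffWithinAt {f : D → E} {s : Set D} {x : D}
    {n : ℕ∞ω} (hn : n ≠ 0) (hn' : n ≠ ∞) (hx : x ∈ s) (hf : ContDiffWithinAt 𝕜 n f s x) :
    ∀ᶠ t in 𝓝[s] x, DifferentiableWithinAt 𝕜 f s t := by
  have h := hf.eventually hn'
  rw [Set.insert_eq_of_mem hx] at h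
  exact h.mono fun t ht ↦ ht.differentiableWithinAt hn

theorem contDiffWithinAt_of_form_apply [CompleteSpace 𝕜] [FiniteDimensional 𝕜 E] {n : ℕ∞ω}
    {b : E →L[𝕜] E →L[𝕜] 𝕜} (hb : Function.Injective b) {P : D → E →L[𝕜] E} {s : Set D} {x : D}
    (hP : ∀ v w, ContDiffWithinAt 𝕜 n (fun t ↦ b (P t v) w) s x) : ContDiffWithinAt 𝕜 n P s x :=
  contDiffWithinAt_clm_apply_iff.2 fun v ↦ contDiffWithinAt_of_injective_comp hb
    (contDiffWithinAt_clm_apply_iff.2 fun w ↦ hP v w)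

theorem leftInverse_inverse_of_injective [CompleteSpace 𝕜] [FiniteDimensional 𝕜 E]
    {P : E →L[𝕜] E} (hP : Function.Injective P) : Function.LeftInverse P.inverse P := by
  let e : E ≃L[𝕜] E := (LinearEquiv.ofInjectiveEndo P.toLinearMap hP).toContinuousLinearEquiv
  have he : P = e := rfl
  intro v
  rw [he, ContinuousLinearMap.inverse_equiv]
  exact e.symm_apply_apply v

section SecondDerivative

variable {s : Set 𝕜} {x : 𝕜} {f : 𝕜 → E} {g : 𝕜 → F}

theorem hasDerivWithinAt_derivWithin_of_contDiffWithinAt (hs : UniqueDiffOn 𝕜 s) (hx : x ∈ s)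
    (hf : ContDiffWithinAt 𝕜 2 f s x) :
    HasDerivWithinAt (derivWithin f s) (iteratedDerivWithin 2 f s x) s x := by
  have h := hf.differentiableWithinAt_iteratedDerivWithin (m := 1) (by norm_num)
    (by rwa [Set.insert_eq_of_mem hx])
  have h' := h.hasDerivWithinAt
  rwa [← iteratedDerivWithin_succ, iteratedDerivWithin_one] at h'

theorem iteratedDerivWithin_two_of_bilinear (B : E →L[𝕜] F →L[𝕜] F') (hs : UniqueDiffOn 𝕜 s)
    (hx : x ∈ s) (hf : ContDiffWithinAt 𝕜 2 f s x) (hg : ContDiffWithinAt 𝕜 2 g s x) :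
    iteratedDerivWithin 2 (fun t ↦ B (f t) (g t)) s x =
      B (f x) (iteratedDerivWithin 2 g s x) +
        (2 : 𝕜) • B (derivWithin f s x) (derivWithin g s x) +
        B (iteratedDerivWithin 2 f s x) (g x) := by
  have product_rule : derivWithin (fun t ↦ B (f t) (g t)) s =ᶠ[𝓝[s] x]
      fun t ↦ B (f t) (derivWithin g s t) + B (derivWithin f s t) (g t) := by
    filter_upwards
      [eventually_differentiableWithinAt_of_contDiffWithinAt two_ne_zero (by simp) hx hf,
      eventually_differentiableWithinAt_of_contDiffWithinAt two_ne_zero (by simp) hx hg]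
      with t hft hgt
    exact B.derivWithin_of_bilinear hft hgt
  have hf' := (hf.differentiableWithinAt two_ne_zero).hasDerivWithinAt
  have hg' := (hg.differentiableWithinAt two_ne_zero).hasDerivWithinAt
  have hf'' := hasDerivWithinAt_derivWithin_of_contDiffWithinAt hs hx hf
  have hg'' := hasDerivWithinAt_derivWithin_of_contDiffWithinAt hs hx hg
  have second_derivative :=
    (B.hasDerivWithinAt_of_bilinear hf' hg'').add (B.hasDerivWithinAt_of_bilinear hf'' hg')
  rw [iteratedDerivWithin_succ, iteratedDerivWithin_one, product_rule.derivWithin_eq_of_mem hx]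
  refine (second_derivative.derivWithin (hs x hx)).trans ?_
  rw [two_smul]
  abel

/-- The function `f` is of class `C²` at `x` within `s`, vanishes at `x` and has derivative `f'`
there. -/
structure HasZeroWithinAt (f : 𝕜 → E) (f' : E) (s : Set 𝕜) (x : 𝕜) : Prop where
  contDiffWithinAt : ContDiffWithinAt 𝕜 2 f s x
  eq_zero : f x = 0
  hasDerivWithinAt : HasDerivWithinAt f f' s x

/-- The function `f` is of class `C²` at `x` within `s`, vanishes at `x` together with its
derivative, and has second derivative `f''` there. -/
structure HasDoubleZeroWithinAt (f : 𝕜 → E) (f'' : E) (s : Set 𝕜) (x : 𝕜) : Prop where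
  contDiffWithinAt : ContDiffWithinAt 𝕜 2 f s x
  eq_zero : f x = 0
  derivWithin_eq_zero : derivWithin f s x = 0
  iteratedDerivWithin_two : iteratedDerivWithin 2 f s x = f''

namespace HasZeroWithinAt

variable {f' : E} {g' : F}

theorem of_clm_apply (L : E →L[𝕜] F) (hf : ContDiffWithinAt 𝕜 2 f s x)
    (hf' : HasDerivWithinAt f f' s x) (hL : L (f x) = 0) :
    HasZeroWithinAt (fun t ↦ L (f t)) (L f') s x where
  contDiffWithinAt := L.contDiff.contDiffAt.comp_contDiffWithinAt x hf
  eq_zero := hL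
  hasDerivWithinAt := L.hasFDerivAt.comp_hasDerivWithinAt x hf'

theorem add {f₁ f₂ : 𝕜 → E} {f₁' f₂' : E} (h₁ : HasZeroWithinAt f₁ f₁' s x)
    (h₂ : HasZeroWithinAt f₂ f₂' s x) :
    HasZeroWithinAt (fun t ↦ f₁ t + f₂ t) (f₁' + f₂') s x where
  contDiffWithinAt := h₁.contDiffWithinAt.add h₂.contDiffWithinAt
  eq_zero := by rw [h₁.eq_zero, h₂.eq_zero, add_zero]
  hasDerivWithinAt := h₁.hasDerivWithinAt.add h₂.hasDerivWithinAt

theorem clm_apply {A : 𝕜 → E →L[𝕜] F} (hf : HasZeroWithinAt f f' s x)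
    (hA : ContDiffWithinAt 𝕜 2 A s x) : HasZeroWithinAt (fun t ↦ A t (f t)) (A x f') s x where
  contDiffWithinAt := hA.clm_apply hf.contDiffWithinAt
  eq_zero := by rw [hf.eq_zero, map_zero]
  hasDerivWithinAt := by
    simpa [hf.eq_zero] using
      (hA.differentiableWithinAt two_ne_zero).hasDerivWithinAt.clm_apply hf.hasDerivWithinAt

theorem bilinear (B : E →L[𝕜] F →L[𝕜] F') (hs : UniqueDiffOn 𝕜 s) (hx : x ∈ s)
    (hf : HasZeroWithinAt f f' s x) (hg : HasZeroWithinAt g g' s x) :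
    HasDoubleZeroWithinAt (fun t ↦ B (f t) (g t)) ((2 : 𝕜) • B f' g') s x where
  contDiffWithinAt := (B.contDiff.contDiffAt.comp_contDiffWithinAt x hf.contDiffWithinAt).clm_apply
    hg.contDiffWithinAt
  eq_zero := by rw [hf.eq_zero, hg.eq_zero, map_zero]
  derivWithin_eq_zero := by
    rw [(B.hasDerivWithinAt_of_bilinear hf.hasDerivWithinAt hg.hasDerivWithinAt).derivWithin
      (hs x hx), hf.eq_zero, hg.eq_zero, map_zero, map_zero, zero_apply, add_zero]
  iteratedDerivWithin_two := by
    rw [iteratedDerivWithin_two_of_bilinear B hs hx hf.contDiffWithinAt hg.contDiffWithinAt,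
      hf.hasDerivWithinAt.derivWithin (hs x hx), hg.hasDerivWithinAt.derivWithin (hs x hx),
      hf.eq_zero, hg.eq_zero, map_zero, map_zero, zero_apply, zero_add, add_zero]

end HasZeroWithinAt

namespace HasDoubleZeroWithinAt

variable {f₁ f₂ : 𝕜 → E} {f₁'' f₂'' : E}

theorem congr (h : HasDoubleZeroWithinAt f₁ f₁'' s x) (heq : Set.EqOn f₂ f₁ s) (hx : x ∈ s) :
    HasDoubleZeroWithinAt f₂ f₁'' s x where
  contDiffWithinAt := h.contDiffWithinAt.congr_of_mem heq hx
  eq_zero := (heq hx).trans h.eq_zero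
  derivWithin_eq_zero := (derivWithin_congr heq (heq hx)).trans h.derivWithin_eq_zero
  iteratedDerivWithin_two := (iteratedDerivWithin_congr heq hx).trans h.iteratedDerivWithin_two

theorem sub (hs : UniqueDiffOn 𝕜 s) (hx : x ∈ s) (h₁ : HasDoubleZeroWithinAt f₁ f₁'' s x)
    (h₂ : HasDoubleZeroWithinAt f₂ f₂'' s x) :
    HasDoubleZeroWithinAt (fun t ↦ f₁ t - f₂ t) (f₁'' - f₂'') s x where
  contDiffWithinAt := h₁.contDiffWithinAt.sub h₂.contDiffWithinAt
  eq_zero := by rw [h₁.eq_zero, h₂.eq_zero, sub_zero]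
  derivWithin_eq_zero := by
    rw [derivWithin_fun_sub (h₁.contDiffWithinAt.differentiableWithinAt two_ne_zero)
      (h₂.contDiffWithinAt.differentiableWithinAt two_ne_zero), h₁.derivWithin_eq_zero,
      h₂.derivWithin_eq_zero, sub_zero]
  iteratedDerivWithin_two :=
    (iteratedDerivWithin_sub hx hs h₁.contDiffWithinAt h₂.contDiffWithinAt).trans
      (by rw [h₁.iteratedDerivWithin_two, h₂.iteratedDerivWithin_two])

end HasDoubleZeroWithinAt

theorem hasDoubleZeroWithinAt_curvature_form (ad : E →L[𝕜] E →L[𝕜] E) (b : E →L[𝕜] E →L[𝕜] 𝕜)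
    (c : 𝕜) (hs : UniqueDiffOn 𝕜 s) (hx : x ∈ s) {P Q : 𝕜 → E →L[𝕜] E}
    (hP : ContDiffWithinAt 𝕜 2 P s x) (hQ : ContDiffWithinAt 𝕜 2 Q s x) (hPx : P x = .id 𝕜 E)
    (hQx : Q x = .id 𝕜 E) {X Y X' Y' : E} (hX' : HasDerivWithinAt (fun t ↦ P t X) X' s x)
    (hY' : HasDerivWithinAt (fun t ↦ P t Y) Y' s x) (hXX : ad X X = 0) (hYY : ad Y Y = 0)
    (hXY : ad X Y = 0) (hYX : ad Y X = 0) :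
    HasDoubleZeroWithinAt
      (fun t ↦ c * b (ad X (P t Y) + ad Y (P t X)) (Q t (ad X (P t Y) + ad Y (P t X))) -
        b (ad X (P t X)) (Q t (ad Y (P t Y))))
      (2 * (c * b (ad X Y' + ad Y X') (ad X Y' + ad Y X')) - 2 * b (ad X X') (ad Y Y')) s x := by
  have hPX : ContDiffWithinAt 𝕜 2 (fun t ↦ P t X) s x := hP.clm_apply contDiffWithinAt_const
  have hPY : ContDiffWithinAt 𝕜 2 (fun t ↦ P t Y) s x := hP.clm_apply contDiffWithinAt_const
  have hPx_apply (v : E) : P x v = v := DFunLike.congr_fun hPx v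
  have zero_XX := HasZeroWithinAt.of_clm_apply (ad X) hPX hX' (by rwa [hPx_apply])
  have zero_YY := HasZeroWithinAt.of_clm_apply (ad Y) hPY hY' (by rwa [hPx_apply])
  have zero_sum := (HasZeroWithinAt.of_clm_apply (ad X) hPY hY' (by rwa [hPx_apply])).add
    (HasZeroWithinAt.of_clm_apply (ad Y) hPX hX' (by rwa [hPx_apply]))
  have double_zero := (zero_sum.bilinear (c • b) hs hx (zero_sum.clm_apply hQ)).sub hs hx
    (zero_XX.bilinear b hs hx (zero_YY.clm_apply hQ))
  simpa only [hQx, ContinuousLinearMap.id_apply, smul_apply, smul_eq_mul] using double_zero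

end SecondDerivative

end Calculus

section ChartRepresentation

open VectorField

variable {𝕜 : Type*} [NontriviallyNormedField 𝕜]
  {E : Type*} [NormedAddCommGroup E] [NormedSpace 𝕜 E]
  {H : Type*} [TopologicalSpace H] {I : ModelWithCorners 𝕜 E H}
  {M : Type*} [TopologicalSpace M] [ChartedSpace H M] {x₀ : M}

theorem mpullbackWithin_extChartAt_symm_apply_self [IsManifold I 1 M]
    (V : Π x : M, TangentSpace I x) :
    mpullbackWithin 𝓘(𝕜, E) I (extChartAt I x₀).symm V (Set.range I) (extChartAt I x₀ x₀) =
      V x₀ := by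
  rw [mpullbackWithin_apply]
  refine Eq.trans ?_ (congrArg (fun x ↦ (V x : E)) (extChartAt_to_inv (I := I) x₀))
  rw [mfderivWithin_range_extChartAt_symm]
  exact DFunLike.congr_fun (ContinuousLinearMap.inverse_id (R := 𝕜) (M := E)) _

theorem mlieBracket_eq_zero_of_lieBracket_eq_zero [I.Boundaryless] {V W : Π x : M, TangentSpace I x}
    (h : lieBracket 𝕜 (mpullbackWithin 𝓘(𝕜, E) I (extChartAt I x₀).symm V (Set.range I))
      (mpullbackWithin 𝓘(𝕜, E) I (extChartAt I x₀).symm W (Set.range I)) (extChartAt I x₀ x₀) =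
        0) :
    mlieBracket I V W x₀ = 0 := by
  rw [I.range_eq_univ] at h
  rw [← mlieBracketWithin_univ, mlieBracketWithin_apply]
  simp only [Set.preimage_univ, I.range_eq_univ, Set.univ_inter]
  exact (congrArg _ ((congrFun lieBracketWithin_univ _).trans h)).trans (map_zero _)

end ChartRepresentation

section PartialDerivatives

variable {𝕜 : Type*} [NontriviallyNormedField 𝕜]
  {E : Type*} [NormedAddCommGroup E] [NormedSpace 𝕜 E]

theorem lieBracket_eq_zero_of_eventuallyEq_partial_fderiv {μ : E × E → E} {e x y : E} {V W : E → E}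
    (hμ : ContDiffAt 𝕜 (minSmoothness 𝕜 2) μ (e, e))
    (hV : V =ᶠ[𝓝 e] fun v ↦ fderiv 𝕜 μ (v, e) (0, x))
    (hW : W =ᶠ[𝓝 e] fun v ↦ fderiv 𝕜 μ (e, v) (y, 0)) (hVe : V e = x) (hWe : W e = y) :
    VectorField.lieBracket 𝕜 V W e = 0 := by
  have hsymm : IsSymmSndFDerivAt 𝕜 μ (e, e) := hμ.isSymmSndFDerivAt le_rfl
  have hμ' : HasFDerivAt (fderiv 𝕜 μ) (fderiv 𝕜 (fderiv 𝕜 μ) (e, e)) (e, e) :=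
    (((hμ.of_le le_minSmoothness).fderiv_right (m := 1) one_add_one_eq_two.le).differentiableAt
      one_ne_zero).hasFDerivAt
  have hV' := ((HasFDerivAt.comp (f := fun v ↦ (v, e)) e hμ'
    (hasFDerivAt_prodMk_left e e)).clm_apply (hasFDerivAt_const (0, x) e)).congr_of_eventuallyEq hV
  have hW' := ((HasFDerivAt.comp (f := fun v ↦ (e, v)) e hμ'
    (hasFDerivAt_prodMk_right e e)).clm_apply (hasFDerivAt_const (y, 0) e)).congr_of_eventuallyEq hW
  rw [VectorField.lieBracket, hV'.fderiv, hW'.fderiv, hVe, hWe]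
  simp [hsymm.eq (0, x) (y, 0)]

end PartialDerivatives

section InvariantVectorFields

open Bundle VectorField

variable {𝕜 : Type*} [NontriviallyNormedField 𝕜]
  {E : Type*} [NormedAddCommGroup E] [NormedSpace 𝕜 E]
  {H : Type*} [TopologicalSpace H] {I : ModelWithCorners 𝕜 E H}
  {G : Type*} [TopologicalSpace G] [ChartedSpace H G] [Group G]

/-- The right-invariant vector field with value `v` at the identity, the counterpart of
`mulInvariantVectorField`. -/
def rightInvariantVectorField (v : GroupLieAlgebra I G) (g : G) : TangentSpace I g :=
  mfderiv I I (fun x ↦ x * g) (1 : G) v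

theorem mulInvariantVectorField_one (v : GroupLieAlgebra I G) :
    mulInvariantVectorField v (1 : G) = v := by
  have h : (fun y : G ↦ 1 * y) = id := funext one_mul
  have h' := DFunLike.congr_fun (mfderiv_id (I := I) (x := (1 : G))) v
  rwa [← h] at h'

theorem rightInvariantVectorField_one (v : GroupLieAlgebra I G) :
    rightInvariantVectorField v (1 : G) = v := by
  have h : (fun y : G ↦ y * 1) = id := funext mul_one
  have h' := DFunLike.congr_fun (mfderiv_id (I := I) (x := (1 : G))) v
  rwa [← h] at h'

/-- Multiplication of a Lie group, read in the chart at the identity. -/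
def chartMul (I : ModelWithCorners 𝕜 E H) (G : Type*) [TopologicalSpace G] [ChartedSpace H G]
    [Group G] (p : E × E) : E :=
  extChartAt I (1 : G) ((extChartAt I (1 : G)).symm p.1 * (extChartAt I (1 : G)).symm p.2)

variable [LieGroup I (minSmoothness 𝕜 3) G]

theorem minSmoothness_three_ne_zero : minSmoothness 𝕜 3 ≠ 0 :=
  (lt_of_lt_of_le (by simp) le_minSmoothness).ne'

theorem contMDiff_rightInvariantVectorField (v : GroupLieAlgebra I G) :
    CMDiff (minSmoothness 𝕜 2)
      (fun (g : G) ↦ (rightInvariantVectorField v g : TangentBundle I G)) := by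
  have two_add_one : minSmoothness 𝕜 2 + 1 = minSmoothness 𝕜 3 := by
    rw [← minSmoothness_add]
    norm_num
  let pair : G → TangentBundle I G × TangentBundle I G :=
    fun g ↦ (TotalSpace.mk' E 1 v, TotalSpace.mk' E g 0)
  have contMDiff_pair : CMDiff (minSmoothness 𝕜 2) pair :=
    contMDiff_const.prodMk (contMDiff_zeroSection _ _)
  have contMDiff_tangentMap_mul : CMDiff (minSmoothness 𝕜 2)
      (tangentMap% (fun (p : G × G) ↦ p.1 * p.2)) :=
    (contMDiff_mul I (minSmoothness 𝕜 3)).contMDiff_tangentMap two_add_one.le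
  convert! (contMDiff_tangentMap_mul.comp contMDiff_equivTangentBundleProd_symm).comp
    contMDiff_pair with g
  · simp [pair]
  · simp only [Function.comp_apply, tangentMap, pair]
    rw [mfderiv_prod_eq_add_apply ((contMDiff_mul I (minSmoothness 𝕜 3)).mdifferentiableAt
      minSmoothness_three_ne_zero)]
    exact (add_eq_left (a := (mfderiv I I (fun x : G ↦ x * g) 1 v : E))).2
      (map_zero (mfderiv I I (fun z : G ↦ 1 * z) g)) |>.symm

theorem mdifferentiableAt_rightInvariantVectorField (v : GroupLieAlgebra I G) (g : G) :
    MDiffAt (T% (rightInvariantVectorField v : Π g : G, TangentSpace I g)) g :=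
  (contMDiff_rightInvariantVectorField v).mdifferentiable
    (lt_of_lt_of_le (by simp) le_minSmoothness).ne' g

theorem surjective_mulInvariantVectorField_apply (g : G) :
    Function.Surjective fun v : GroupLieAlgebra I G ↦ mulInvariantVectorField v g := by
  intro w
  have comp_eq_id : (mfderiv I I (fun x : G ↦ g * x) (g⁻¹ * g)).comp
      (mfderiv I I (fun x : G ↦ g⁻¹ * x) g) = .id 𝕜 _ := by
    rw [← mfderiv_comp (I' := I) g
      (contMDiff_mul_left.mdifferentiable (minSmoothness_three_ne_zero (𝕜 := 𝕜)) _)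
      (contMDiff_mul_left.mdifferentiable (minSmoothness_three_ne_zero (𝕜 := 𝕜)) _)]
    have h : (fun x : G ↦ g * x) ∘ (fun x ↦ g⁻¹ * x) = id := funext (mul_inv_cancel_left g)
    rw [h, mfderiv_id]
  refine ⟨(mfderiv I I (fun x : G ↦ g⁻¹ * x) g w : E), ?_⟩
  have h := DFunLike.congr_fun comp_eq_id w
  rw [inv_mul_cancel] at h
  exact h

variable [I.Boundaryless]

theorem contDiffAt_chartMul :
    ContDiffAt 𝕜 (minSmoothness 𝕜 3) (chartMul I G)
      (extChartAt I (1 : G) 1, extChartAt I (1 : G) 1) := by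
  rw [← contMDiffAt_iff_contDiffAt]
  have hsymm : ContMDiffAt 𝓘(𝕜, E) I (minSmoothness 𝕜 3) (extChartAt I (1 : G)).symm
      (extChartAt I (1 : G) 1) :=
    (contMDiffOn_extChartAt_symm (1 : G)).contMDiffAt (extChartAt_target_mem_nhds 1)
  have hfst := ContMDiffAt.comp (I' := 𝓘(𝕜, E))
    (extChartAt I (1 : G) 1, extChartAt I (1 : G) 1) hsymm contDiff_fst.contMDiff.contMDiffAt
  have hsnd := ContMDiffAt.comp (I' := 𝓘(𝕜, E))
    (extChartAt I (1 : G) 1, extChartAt I (1 : G) 1) hsymm contDiff_snd.contMDiff.contMDiffAt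
  refine ContMDiffAt.comp_of_eq (I' := I) (y := 1) contMDiffAt_extChartAt (hfst.mul hsnd) ?_
  simp

theorem eventually_differentiableAt_chartMul :
    ∀ᶠ p in 𝓝 (extChartAt I (1 : G) 1, extChartAt I (1 : G) 1),
      DifferentiableAt 𝕜 (chartMul I G) p := by
  have h : ContDiffAt 𝕜 2 (chartMul I G) (extChartAt I (1 : G) 1, extChartAt I (1 : G) 1) :=
    contDiffAt_chartMul.of_le ((by norm_num : (2 : ℕ∞ω) ≤ 3).trans le_minSmoothness)
  filter_upwards [h.eventually (by simp)] with p hp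
  exact hp.differentiableAt two_ne_zero

theorem inverse_mfderivWithin_extChartAt_symm_mfderiv {F : G → G} {v : E}
    (hv : v ∈ (extChartAt I (1 : G)).target) (hF : MDiffAt F (1 : G))
    (hF_one : F 1 = (extChartAt I (1 : G)).symm v) (x : GroupLieAlgebra I G) :
    ((mfderiv[Set.range I] (extChartAt I (1 : G)).symm v).inverse (mfderiv I I F 1 x : E) : E) =
      fderiv 𝕜 (extChartAt I (1 : G) ∘ F ∘ (extChartAt I (1 : G)).symm) (extChartAt I (1 : G) 1)
        x := by
  have : IsManifold I 1 G :=
    IsManifold.of_le (n := minSmoothness 𝕜 3) (le_trans (by norm_num) le_minSmoothness)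
  have hchart : MDiffAt (extChartAt I (1 : G)) (F 1) :=
    hF_one ▸ mdifferentiableAt_extChartAt (extChartAt_source (I := I) (1 : G) ▸
      (extChartAt I (1 : G)).map_target hv)
  have inverse_eq : (mfderiv[Set.range I] (extChartAt I (1 : G)).symm v).inverse =
      mfderiv% (extChartAt I (1 : G)) ((extChartAt I (1 : G)).symm v) :=
    ContinuousLinearMap.inverse_eq
      (mfderivWithin_extChartAt_symm_comp_mfderiv_extChartAt hv)
      (mfderiv_extChartAt_comp_mfderivWithin_extChartAt_symm hv)
  have mfderiv_eq := (hchart.comp (1 : G) hF).mfderiv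
  rw [mfderiv_comp (I' := I) (1 : G) hchart hF, I.range_eq_univ, fderivWithin_univ,
    hF_one] at mfderiv_eq
  rw [inverse_eq]
  exact DFunLike.congr_fun mfderiv_eq x

theorem mpullbackWithin_mulInvariantVectorField (x : GroupLieAlgebra I G) :
    mpullbackWithin 𝓘(𝕜, E) I (extChartAt I (1 : G)).symm (mulInvariantVectorField x) (Set.range I)
      =ᶠ[𝓝 (extChartAt I (1 : G) 1)]
        fun v ↦ fderiv 𝕜 (chartMul I G) (v, extChartAt I (1 : G) 1) (0, x) := by
  have hcont : Continuous fun v : E ↦ (v, extChartAt I (1 : G) 1) := by fun_prop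
  filter_upwards [extChartAt_target_mem_nhds (I := I) (1 : G),
    (hcont.tendsto _).eventually (eventually_differentiableAt_chartMul (I := I))] with v hv hd
  have hderiv := HasFDerivAt.comp (f := fun w ↦ (v, w)) (extChartAt I (1 : G) 1) hd.hasFDerivAt
    (hasFDerivAt_prodMk_right v _)
  exact (inverse_mfderivWithin_extChartAt_symm_mfderiv hv
    ((contMDiff_mul_left (I := I) (n := minSmoothness 𝕜 3)).mdifferentiableAt
      minSmoothness_three_ne_zero) (by simp) x).trans (DFunLike.congr_fun hderiv.fderiv x)

theorem mpullbackWithin_rightInvariantVectorField (x : GroupLieAlgebra I G) :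
    mpullbackWithin 𝓘(𝕜, E) I (extChartAt I (1 : G)).symm (rightInvariantVectorField x)
      (Set.range I) =ᶠ[𝓝 (extChartAt I (1 : G) 1)]
        fun v ↦ fderiv 𝕜 (chartMul I G) (extChartAt I (1 : G) 1, v) (x, 0) := by
  have hcont : Continuous fun v : E ↦ (extChartAt I (1 : G) 1, v) := by fun_prop
  filter_upwards [extChartAt_target_mem_nhds (I := I) (1 : G),
    (hcont.tendsto _).eventually (eventually_differentiableAt_chartMul (I := I))] with v hv hd
  have hderiv := HasFDerivAt.comp (f := fun w ↦ (w, v)) (extChartAt I (1 : G) 1) hd.hasFDerivAt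
    (hasFDerivAt_prodMk_left _ v)
  exact (inverse_mfderivWithin_extChartAt_symm_mfderiv hv
    ((contMDiff_mul_right (I := I) (n := minSmoothness 𝕜 3)).mdifferentiableAt
      minSmoothness_three_ne_zero) (by simp) x).trans (DFunLike.congr_fun hderiv.fderiv x)

-- The mixed second derivative of the multiplication at `(1, 1)` can be taken in either order.
theorem mlieBracket_mulInvariantVectorField_rightInvariantVectorField
    (x y : GroupLieAlgebra I G) :
    mlieBracket I (mulInvariantVectorField x) (rightInvariantVectorField y) (1 : G) = 0 := by
  have : IsManifold I 1 G :=
    IsManifold.of_le (n := minSmoothness 𝕜 3) (le_trans (by norm_num) le_minSmoothness)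
  refine mlieBracket_eq_zero_of_lieBracket_eq_zero ?_
  exact lieBracket_eq_zero_of_eventuallyEq_partial_fderiv
    (contDiffAt_chartMul.of_le (minSmoothness_monotone (by norm_num)))
    (mpullbackWithin_mulInvariantVectorField x) (mpullbackWithin_rightInvariantVectorField y)
    ((mpullbackWithin_extChartAt_symm_apply_self (x₀ := (1 : G)) _).trans
      (mulInvariantVectorField_one x))
    ((mpullbackWithin_extChartAt_symm_apply_self (x₀ := (1 : G)) _).trans
      (rightInvariantVectorField_one y))

end InvariantVectorFields

section MetricLieAlgebra

variable {R L : Type*} [CommRing R] [LieRing L] [LieAlgebra R L] {B : LinearMap.BilinForm R L}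

theorem lieInvariant_apply_lie_lie_of_lie_eq_zero (hB : B.lieInvariant L) {X Y : L}
    (hXY : ⁅X, Y⁆ = 0) (U V : L) : B ⁅X, U⁆ ⁅Y, V⁆ = B ⁅Y, U⁆ ⁅X, V⁆ := by
  rw [hB, hB Y, leibniz_lie X Y V, hXY, zero_lie, zero_add]

theorem lieInvariant_polarization_of_lie_eq_zero (hB : B.lieInvariant L) (hB_symm : B.IsSymm)
    {X Y : L} (hXY : ⁅X, Y⁆ = 0) (U V : L) :
    B (⁅X, V⁆ + ⁅Y, U⁆) (⁅X, V⁆ + ⁅Y, U⁆) - 4 * B ⁅X, U⁆ ⁅Y, V⁆ =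
      B (⁅X, V⁆ + ⁅U, Y⁆) (⁅X, V⁆ + ⁅U, Y⁆) := by
  rw [lieInvariant_apply_lie_lie_of_lie_eq_zero hB hXY, ← lie_skew U Y]
  simp only [map_add, map_neg, LinearMap.add_apply, LinearMap.neg_apply]
  linear_combination (2 : R) * hB_symm.eq ⁅X, V⁆ ⁅Y, U⁆

end MetricLieAlgebra

section LeftInvariantMetric

open Bundle VectorField

variable {E : Type*} [NormedAddCommGroup E] [NormedSpace ℝ E]
  {H : Type*} [TopologicalSpace H] {I : ModelWithCorners ℝ E H}
  {G : Type*} [TopologicalSpace G] [ChartedSpace H G] [Group G] [LieGroup I ∞ G]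

instance lieGroup_minSmoothness_three : LieGroup I (minSmoothness ℝ 3) G :=
  LieGroup.of_le (n := ∞) (by simp only [minSmoothness_of_isRCLikeNormedField]; norm_cast)

theorem SmoothMetric.inner_congr_point (h : SmoothMetric I G) {a b : G} (hab : a = b) (v w : E) :
    h.inner a v w = h.inner b v w := by
  subst hab; rfl

theorem IsLeftInvariant.inner_mulInvariantVectorField {h : SmoothMetric I G}
    (hl : IsLeftInvariant h) (g : G) (X Y : GroupLieAlgebra I G) :
    h.inner g (mulInvariantVectorField X g) (mulInvariantVectorField Y g) = h.inner 1 X Y :=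
  (h.inner_congr_point (mul_one g).symm _ _).trans (hl g 1 X Y)

theorem IsRightInvariant.inner_rightInvariantVectorField {h : SmoothMetric I G}
    (hr : IsRightInvariant h) (g : G) (X Y : GroupLieAlgebra I G) :
    h.inner g (rightInvariantVectorField X g) (rightInvariantVectorField Y g) = h.inner 1 X Y :=
  (h.inner_congr_point (one_mul g).symm _ _).trans (hr g 1 X Y)

/-- The operation `(X, Y) ↦ ∇_X Y` induced on the Lie algebra by a connection: `Y` is extended to a
left-invariant vector field, and `∇_X Y` is evaluated at the identity. -/
def AffineConnection.onLieAlgebra (cov : AffineConnection I G) (X Y : GroupLieAlgebra I G) :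
    GroupLieAlgebra I G :=
  cov (mulInvariantVectorField Y) 1 X

variable {h : SmoothMetric I G} {cov : AffineConnection I G}

theorem IsLeviCivita.inner_mulInvariantVectorField_skew (hc : IsLeviCivita h cov)
    (hl : IsLeftInvariant h) (g : G) (v : TangentSpace I g) (Y Z : GroupLieAlgebra I G) :
    h.inner g (cov (mulInvariantVectorField Y) g v) (mulInvariantVectorField Z g) =
      -h.inner g (mulInvariantVectorField Y g) (cov (mulInvariantVectorField Z) g v) := by
  rw [eq_neg_iff_add_eq_zero, ← hc.metric v (mdifferentiableAt_mulInvariantVectorField Y)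
    (mdifferentiableAt_mulInvariantVectorField Z),
    funext fun y ↦ hl.inner_mulInvariantVectorField y Y Z, mvfderiv_const]
  rfl

theorem IsLeviCivita.inner_onLieAlgebra_skew (hc : IsLeviCivita h cov) (hl : IsLeftInvariant h)
    (X Y Z : GroupLieAlgebra I G) :
    h.inner 1 (cov.onLieAlgebra X Y) Z = -h.inner 1 Y (cov.onLieAlgebra X Z) := by
  have := hc.inner_mulInvariantVectorField_skew hl 1 X Y Z
  rwa [mulInvariantVectorField_one, mulInvariantVectorField_one] at this

theorem IsLeviCivita.cov_rightInvariantVectorField_one [I.Boundaryless] (hc : IsLeviCivita h cov)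
    (X Y : GroupLieAlgebra I G) :
    cov (rightInvariantVectorField Y) 1 X = cov.onLieAlgebra Y X := by
  have := hc.torsion_free (mdifferentiableAt_mulInvariantVectorField (g := (1 : G)) X)
    (mdifferentiableAt_rightInvariantVectorField Y 1)
  rw [mlieBracket_mulInvariantVectorField_rightInvariantVectorField,
    mulInvariantVectorField_one, rightInvariantVectorField_one] at this
  exact sub_eq_zero.1 this

variable [CompleteSpace E]

theorem IsLeviCivita.torsion_free_mulInvariantVectorField (hc : IsLeviCivita h cov)
    (g : G) (X Y : GroupLieAlgebra I G) :
    cov (mulInvariantVectorField Y) g (mulInvariantVectorField X g) -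
      cov (mulInvariantVectorField X) g (mulInvariantVectorField Y g) =
      mulInvariantVectorField ⁅X, Y⁆ g := by
  rw [hc.torsion_free (mdifferentiableAt_mulInvariantVectorField X)
    (mdifferentiableAt_mulInvariantVectorField Y)]
  exact (congrFun (mulInvariantVector_mlieBracket X Y) g).symm

theorem IsLeviCivita.onLieAlgebra_sub_swap (hc : IsLeviCivita h cov) (X Y : GroupLieAlgebra I G) :
    cov.onLieAlgebra X Y - cov.onLieAlgebra Y X = ⁅X, Y⁆ := by
  have := hc.torsion_free_mulInvariantVectorField 1 X Y
  rwa [mulInvariantVectorField_one, mulInvariantVectorField_one,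
    mulInvariantVectorField_one] at this

theorem IsLeviCivita.koszul_mulInvariantVectorField (hc : IsLeviCivita h cov)
    (hl : IsLeftInvariant h) (g : G) (X Y Z : GroupLieAlgebra I G) :
    2 * h.inner g (cov (mulInvariantVectorField Y) g (mulInvariantVectorField X g))
      (mulInvariantVectorField Z g) =
      h.inner 1 ⁅X, Y⁆ Z - h.inner 1 ⁅X, Z⁆ Y - h.inner 1 ⁅Y, Z⁆ X := by
  have torsion (A B C : GroupLieAlgebra I G) :
      h.inner g (cov (mulInvariantVectorField B) g (mulInvariantVectorField A g))
        (mulInvariantVectorField C g) -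
      h.inner g (cov (mulInvariantVectorField A) g (mulInvariantVectorField B g))
        (mulInvariantVectorField C g) = h.inner 1 ⁅A, B⁆ C := by
    rw [← hl.inner_mulInvariantVectorField g ⁅A, B⁆ C,
      ← hc.torsion_free_mulInvariantVectorField g A B, map_sub, sub_apply]
  have skew (A B C : GroupLieAlgebra I G) :
      h.inner g (cov (mulInvariantVectorField B) g (mulInvariantVectorField A g))
        (mulInvariantVectorField C g) =
      -h.inner g (cov (mulInvariantVectorField C) g (mulInvariantVectorField A g))
        (mulInvariantVectorField B g) := by
    rw [hc.inner_mulInvariantVectorField_skew hl, h.symm]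
  linear_combination torsion X Y Z - torsion X Z Y - torsion Y Z X + skew X Y Z + skew Y X Z
    - skew Z X Y

theorem IsLeviCivita.two_mul_inner_onLieAlgebra (hc : IsLeviCivita h cov) (hl : IsLeftInvariant h)
    (X Y Z : GroupLieAlgebra I G) :
    2 * h.inner 1 (cov.onLieAlgebra X Y) Z =
      h.inner 1 ⁅X, Y⁆ Z - h.inner 1 ⁅X, Z⁆ Y - h.inner 1 ⁅Y, Z⁆ X := by
  have := hc.koszul_mulInvariantVectorField hl 1 X Y Z
  rwa [mulInvariantVectorField_one, mulInvariantVectorField_one] at this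

theorem IsLeviCivita.cov_mulInvariantVectorField (hc : IsLeviCivita h cov)
    (hl : IsLeftInvariant h) (X Y : GroupLieAlgebra I G) :
    (fun g : G ↦ cov (mulInvariantVectorField Y) g (mulInvariantVectorField X g)) =
      mulInvariantVectorField (cov.onLieAlgebra X Y) := by
  funext g
  refine h.ext_inner fun w ↦ ?_
  obtain ⟨Z, rfl⟩ := surjective_mulInvariantVectorField_apply g w
  rw [hl.inner_mulInvariantVectorField]
  linarith [hc.koszul_mulInvariantVectorField hl g X Y Z, hc.two_mul_inner_onLieAlgebra hl X Y Z]

theorem IsLeviCivita.curvatureField_mulInvariantVectorField (hc : IsLeviCivita h cov)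
    (hl : IsLeftInvariant h) (X Y Z : GroupLieAlgebra I G) :
    curvatureField cov (mulInvariantVectorField X) (mulInvariantVectorField Y)
        (mulInvariantVectorField Z) 1 =
      cov.onLieAlgebra X (cov.onLieAlgebra Y Z) - cov.onLieAlgebra Y (cov.onLieAlgebra X Z) -
        cov.onLieAlgebra ⁅X, Y⁆ Z := by
  rw [curvatureField, hc.cov_mulInvariantVectorField hl, hc.cov_mulInvariantVectorField hl,
    mulInvariantVectorField_one, mulInvariantVectorField_one, ← GroupLieAlgebra.bracket_def]
  rfl

theorem IsLeviCivita.inner_curvatureField_of_lie_eq_zero (hc : IsLeviCivita h cov)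
    (hl : IsLeftInvariant h) {X Y : GroupLieAlgebra I G} (hXY : ⁅X, Y⁆ = 0) :
    h.inner 1 (curvatureField cov (mulInvariantVectorField X) (mulInvariantVectorField Y)
        (mulInvariantVectorField Y) 1) X =
      h.inner 1 (cov.onLieAlgebra X Y) (cov.onLieAlgebra X Y) -
        h.inner 1 (cov.onLieAlgebra X X) (cov.onLieAlgebra Y Y) := by
  have hcomm : cov.onLieAlgebra Y X = cov.onLieAlgebra X Y :=
    (sub_eq_zero.1 ((hc.onLieAlgebra_sub_swap X Y).trans hXY)).symm
  have hzero : cov.onLieAlgebra 0 Y = 0 := map_zero (cov (mulInvariantVectorField Y) 1)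
  rw [hc.curvatureField_mulInvariantVectorField hl, hXY, hzero, sub_zero, map_sub, sub_apply,
    h.symm 1 _ X, hc.inner_onLieAlgebra_skew hl Y, hcomm]
  linear_combination hc.inner_onLieAlgebra_skew hl X X (cov.onLieAlgebra Y Y)

theorem IsLeviCivita.lieInvariant_of_isBiInvariant [I.Boundaryless] (hc : IsLeviCivita h cov)
    (hb : IsBiInvariant h) : (h.inner 1).toBilinForm.lieInvariant (GroupLieAlgebra I G) := by
  intro X Y Z
  have inner_right_const : h.inner 1 (cov.onLieAlgebra Y X) Z +
      h.inner 1 Y (cov.onLieAlgebra Z X) = 0 := by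
    have := hc.metric X (mdifferentiableAt_rightInvariantVectorField Y 1)
      (mdifferentiableAt_rightInvariantVectorField Z 1)
    simp only [hb.2.inner_rightInvariantVectorField, mvfderiv_const, zero_apply,
      hc.cov_rightInvariantVectorField_one, rightInvariantVectorField_one] at this
    exact this.symm
  have := hc.inner_onLieAlgebra_skew hb.1 X Y Z
  change h.inner 1 ⁅X, Y⁆ Z = -h.inner 1 Y ⁅X, Z⁆
  rw [← hc.onLieAlgebra_sub_swap, ← hc.onLieAlgebra_sub_swap, map_sub, sub_apply, map_sub]
  linarith

end LeftInvariantMetric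

section DeformedMetric

variable {E : Type*} [NormedAddCommGroup E] [NormedSpace ℝ E] [CompleteSpace E]
  {H : Type*} [TopologicalSpace H] {I : ModelWithCorners ℝ E H}
  {G : Type*} [TopologicalSpace G] [ChartedSpace H G] [Group G] [LieGroup I ∞ G]
  {h₀ h : SmoothMetric I G} {cov : AffineConnection I G}
  {Φ Q : GroupLieAlgebra I G →ₗ[ℝ] GroupLieAlgebra I G}

theorem IsLeviCivita.two_smul_map_onLieAlgebra (hc : IsLeviCivita h cov) (hl : IsLeftInvariant h)
    (h₀_inv : (h₀.inner 1).toBilinForm.lieInvariant (GroupLieAlgebra I G))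
    (hΦ : ∀ A B : GroupLieAlgebra I G, h.inner 1 A B = h₀.inner 1 (Φ A) B)
    (X Y : GroupLieAlgebra I G) :
    (2 : ℝ) • Φ (cov.onLieAlgebra X Y) = Φ ⁅X, Y⁆ + ⁅X, Φ Y⁆ + ⁅Y, Φ X⁆ := by
  refine h₀.ext_inner fun Z ↦ ?_
  have invariance (A B : GroupLieAlgebra I G) :
      h₀.inner 1 ⁅A, Φ B⁆ Z = -h.inner 1 ⁅A, Z⁆ B := by
    rw [h.symm, hΦ]
    exact h₀_inv A (Φ B) Z
  rw [map_smul, smul_apply, smul_eq_mul, ← hΦ, hc.two_mul_inner_onLieAlgebra hl, map_add, map_add,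
    add_apply, add_apply, ← hΦ, invariance, invariance]
  ring

theorem IsLeviCivita.inner_curvatureField_of_leftInverse (hc : IsLeviCivita h cov)
    (hl : IsLeftInvariant h)
    (h₀_inv : (h₀.inner 1).toBilinForm.lieInvariant (GroupLieAlgebra I G))
    (hΦ : ∀ A B : GroupLieAlgebra I G, h.inner 1 A B = h₀.inner 1 (Φ A) B)
    (hQ : Function.LeftInverse Q Φ) {X Y : GroupLieAlgebra I G} (hXY : ⁅X, Y⁆ = 0) :
    h.inner 1 (curvatureField cov (mulInvariantVectorField X) (mulInvariantVectorField Y)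
        (mulInvariantVectorField Y) 1) X =
      (1 / 4) * h₀.inner 1 (⁅X, Φ Y⁆ + ⁅Y, Φ X⁆) (Q (⁅X, Φ Y⁆ + ⁅Y, Φ X⁆)) -
        h₀.inner 1 ⁅X, Φ X⁆ (Q ⁅Y, Φ Y⁆) := by
  have map_eq (A B : GroupLieAlgebra I G) (hAB : ⁅A, B⁆ = 0) :
      ⁅A, Φ B⁆ + ⁅B, Φ A⁆ = (2 : ℝ) • Φ (cov.onLieAlgebra A B) := by
    rw [hc.two_smul_map_onLieAlgebra hl h₀_inv hΦ, hAB, map_zero, zero_add]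
  have map_self (A : GroupLieAlgebra I G) : ⁅A, Φ A⁆ = Φ (cov.onLieAlgebra A A) :=
    smul_right_injective _ (two_ne_zero (α := ℝ))
      ((two_smul ℝ _).trans (map_eq A A (lie_self A)))
  rw [hc.inner_curvatureField_of_lie_eq_zero hl hXY, map_eq X Y hXY, map_self, map_self, hΦ, hΦ]
  simp only [map_smul, smul_apply, smul_eq_mul, hQ _]
  ring

end DeformedMetric

section MetricPath

variable {E : Type*} [NormedAddCommGroup E] [NormedSpace ℝ E]
  {H : Type*} [TopologicalSpace H] {I : ModelWithCorners ℝ E H}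
  {G : Type*} [TopologicalSpace G] [ChartedSpace H G] [Group G] [LieGroup I ∞ G]

theorem SmoothMetric.injective_inner (h : SmoothMetric I G) (x : G) :
    Function.Injective (h.inner x) :=
  fun _ _ heq ↦ h.ext_inner fun w ↦ DFunLike.congr_fun heq w

theorem SmoothMetric.injective_of_inner_eq {h₀ h : SmoothMetric I G} {x : G}
    {Φ : TangentSpace I x →ₗ[ℝ] TangentSpace I x}
    (hΦ : ∀ A B, h.inner x A B = h₀.inner x (Φ A) B) : Function.Injective Φ :=
  fun A A' heq ↦ h.ext_inner fun B ↦ by rw [hΦ, hΦ, heq]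

theorem SmoothMetric.inner_self_nonneg (h : SmoothMetric I G) {x : G} (v : TangentSpace I x) :
    0 ≤ h.inner x v v := by
  obtain rfl | hv := eq_or_ne v 0
  · rw [map_zero]
  · exact (h.pos x v hv).le

variable [FiniteDimensional ℝ E]

variable (I G) in
/-- The Lie bracket of a Lie group as a continuous bilinear map. It is stated on the model space
`E`, which carries the norm that the type synonym `GroupLieAlgebra I G` of `E` lacks. -/
def lieBracketCLM : E →L[ℝ] E →L[ℝ] E :=
  have : CompleteSpace E := FiniteDimensional.complete ℝ E
  have ad : GroupLieAlgebra I G →ₗ[ℝ] GroupLieAlgebra I G →ₗ[ℝ] GroupLieAlgebra I G :=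
    LieModule.toEnd ℝ (GroupLieAlgebra I G) (GroupLieAlgebra I G)
  LinearMap.toContinuousBilinearMap (E := E) (F := E) (G := E) ad

theorem hasDerivWithinAt_lie {A B : ℝ → GroupLieAlgebra I G} {A' B' : GroupLieAlgebra I G}
    {s : Set ℝ} {t : ℝ} (hA : HasDerivWithinAt A A' s t) (hB : HasDerivWithinAt B B' s t) :
    HasDerivWithinAt (fun t ↦ ⁅A t, B t⁆) (⁅A t, B'⁆ + ⁅A', B t⁆) s t :=
  (lieBracketCLM I G).hasDerivWithinAt_of_bilinear hA hB

variable [I.Boundaryless]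

theorem lieSectionalCurvature_of_leftInverse {h₀ h : SmoothMetric I G} (h_left : IsLeftInvariant h)
    (h₀_biinv : IsBiInvariant h₀) {Φ Q : GroupLieAlgebra I G →ₗ[ℝ] GroupLieAlgebra I G}
    (hΦ : ∀ A B : GroupLieAlgebra I G, h.inner 1 A B = h₀.inner 1 (Φ A) B)
    (hQ : Function.LeftInverse Q Φ) {X Y : GroupLieAlgebra I G} (hXY : ⁅X, Y⁆ = 0) :
    lieSectionalCurvature h X Y =
      (1 / 4) * h₀.inner 1 (⁅X, Φ Y⁆ + ⁅Y, Φ X⁆) (Q (⁅X, Φ Y⁆ + ⁅Y, Φ X⁆)) -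
        h₀.inner 1 ⁅X, Φ X⁆ (Q ⁅Y, Φ Y⁆) := by
  have : CompleteSpace E := FiniteDimensional.complete ℝ E
  have h₀_inv := (isLeviCivita_leviCivita h₀).lieInvariant_of_isBiInvariant h₀_biinv
  rw [lieSectionalCurvature, unnormalizedSectionalCurvature, mulInvariantVectorField_one]
  exact (isLeviCivita_leviCivita h).inner_curvatureField_of_leftInverse h_left h₀_inv hΦ hQ hXY

theorem IsBiInvariant.inner_polarization_of_lie_eq_zero {h : SmoothMetric I G}
    (hb : IsBiInvariant h) {X Y : GroupLieAlgebra I G} (hXY : ⁅X, Y⁆ = 0)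
    (U V : GroupLieAlgebra I G) :
    h.inner 1 (⁅X, V⁆ + ⁅Y, U⁆) (⁅X, V⁆ + ⁅Y, U⁆) - 4 * h.inner 1 ⁅X, U⁆ ⁅Y, V⁆ =
      h.inner 1 (⁅X, V⁆ + ⁅U, Y⁆) (⁅X, V⁆ + ⁅U, Y⁆) :=
  have : CompleteSpace E := FiniteDimensional.complete ℝ E
  lieInvariant_polarization_of_lie_eq_zero
    ((isLeviCivita_leviCivita h).lieInvariant_of_isBiInvariant hb) ⟨h.symm 1⟩ hXY U V

variable {J : Set ℝ} {h : ℝ → SmoothMetric I G}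
  {Φ : ℝ → GroupLieAlgebra I G →ₗ[ℝ] GroupLieAlgebra I G}

theorem hasDoubleZeroWithinAt_lieSectionalCurvature (hJ : UniqueDiffOn ℝ J)
    (hJ_zero : (0 : ℝ) ∈ J) (h_left : ∀ t ∈ J, IsLeftInvariant (h t)) (h_zero : IsBiInvariant (h 0))
    (h_smooth : ∀ A B : GroupLieAlgebra I G,
      ContDiffWithinAt ℝ 2 (fun t ↦ (h t).inner 1 A B) J 0)
    (hΦ : ∀ t ∈ J, ∀ A B : GroupLieAlgebra I G, (h t).inner 1 A B = (h 0).inner 1 (Φ t A) B)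
    {X Y X' Y' : GroupLieAlgebra I G} (hX' : HasDerivWithinAt (fun t ↦ Φ t X) X' J 0)
    (hY' : HasDerivWithinAt (fun t ↦ Φ t Y) Y' J 0) (hXY : ⁅X, Y⁆ = 0) :
    HasDoubleZeroWithinAt (fun t ↦ lieSectionalCurvature (h t) X Y)
      (1 / 2 * (h 0).inner 1 (⁅X, Y'⁆ + ⁅X', Y⁆) (⁅X, Y'⁆ + ⁅X', Y⁆)) J 0 := by
  have hYX : ⁅Y, X⁆ = 0 := by rw [← lie_skew, hXY, neg_zero]
  let P (t : ℝ) : E →L[ℝ] E := LinearMap.toContinuousLinearMap (E := E) (F' := E) (Φ t)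
  have P_contDiff : ContDiffWithinAt ℝ 2 P J 0 :=
    contDiffWithinAt_of_form_apply (E := E) ((h 0).injective_inner 1) fun A B ↦
      (h_smooth A B).congr_of_mem (fun t ht ↦ (hΦ t ht A B).symm) hJ_zero
  have P_zero : P 0 = .id ℝ E :=
    ContinuousLinearMap.ext fun A ↦ (h 0).ext_inner fun B ↦ (hΦ 0 hJ_zero A B).symm
  have inverse_contDiff : ContDiffWithinAt ℝ 2 (fun t ↦ (P t).inverse) J 0 := by
    have : CompleteSpace E := FiniteDimensional.complete ℝ E
    have : ContDiffAt ℝ 2 ContinuousLinearMap.inverse (P 0) :=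
      P_zero ▸ contDiffAt_map_inverse (ContinuousLinearEquiv.refl ℝ E)
    exact this.comp_contDiffWithinAt 0 P_contDiff
  have double_zero := hasDoubleZeroWithinAt_curvature_form (lieBracketCLM I G)
    (b := (h 0).inner 1) (1 / 4) hJ hJ_zero P_contDiff inverse_contDiff P_zero
    (P_zero ▸ ContinuousLinearMap.inverse_id) hX' hY' (lie_self X) (lie_self Y) hXY hYX
  have inverse_left (t : ℝ) (ht : t ∈ J) : Function.LeftInverse (P t).inverse (P t) :=
    leftInverse_inverse_of_injective (SmoothMetric.injective_of_inner_eq (hΦ t ht))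
  have value : 2 * (1 / 4 * (h 0).inner 1 (⁅X, Y'⁆ + ⁅Y, X'⁆) (⁅X, Y'⁆ + ⁅Y, X'⁆)) -
      2 * (h 0).inner 1 ⁅X, X'⁆ ⁅Y, Y'⁆ =
      1 / 2 * (h 0).inner 1 (⁅X, Y'⁆ + ⁅X', Y⁆) (⁅X, Y'⁆ + ⁅X', Y⁆) := by
    linear_combination (1 / 2) * h_zero.inner_polarization_of_lie_eq_zero hXY X' Y'
  rw [← value]
  exact double_zero.congr (fun t ht ↦ lieSectionalCurvature_of_leftInverse (h_left t ht) h_zero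
    (hΦ t ht) (Q := (P t).inverse.toLinearMap) (inverse_left t ht) hXY) hJ_zero

theorem lemma1_general (hJ : UniqueDiffOn ℝ J) (hJ_zero : (0 : ℝ) ∈ J)
    (h_left : ∀ t ∈ J, IsLeftInvariant (h t)) (h_zero : IsBiInvariant (h 0))
    (h_smooth : ∀ A B : GroupLieAlgebra I G,
      ContDiffWithinAt ℝ 2 (fun t ↦ (h t).inner 1 A B) J 0)
    (hΦ : ∀ t ∈ J, ∀ A B : GroupLieAlgebra I G, (h t).inner 1 A B = (h 0).inner 1 (Φ t A) B)
    {Ψ : GroupLieAlgebra I G →ₗ[ℝ] GroupLieAlgebra I G}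
    (hΨ : ∀ A : GroupLieAlgebra I G, HasDerivWithinAt (fun t ↦ Φ t A) (Ψ A) J 0)
    {X Y : GroupLieAlgebra I G} (hXY : ⁅X, Y⁆ = 0)
    {k : ℝ → ℝ} (hk : ∀ t ∈ J, k t = lieSectionalCurvature (h t) X Y) :
    ContDiffWithinAt ℝ 2 k J 0 ∧
    k 0 = 0 ∧
    derivWithin k J 0 = 0 ∧
    2 * iteratedDerivWithin 2 k J 0
      = (h 0).inner 1 (⁅X, Ψ Y⁆ + ⁅Ψ X, Y⁆) (⁅X, Ψ Y⁆ + ⁅Ψ X, Y⁆) ∧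
    (∃ D : GroupLieAlgebra I G, HasDerivWithinAt (fun t ↦ ⁅Φ t X, Φ t Y⁆) D J 0 ∧
      2 * iteratedDerivWithin 2 k J 0 = (h 0).inner 1 D D) ∧
    0 ≤ iteratedDerivWithin 2 k J 0 := by
  have double_zero := (hasDoubleZeroWithinAt_lieSectionalCurvature hJ hJ_zero h_left h_zero h_smooth
    hΦ (hΨ X) (hΨ Y) hXY).congr hk hJ_zero
  have Φ_zero (A : GroupLieAlgebra I G) : Φ 0 A = A :=
    (h 0).ext_inner fun B ↦ (hΦ 0 hJ_zero A B).symm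
  have deriv_lie : HasDerivWithinAt (fun t ↦ ⁅Φ t X, Φ t Y⁆) (⁅X, Ψ Y⁆ + ⁅Ψ X, Y⁆) J 0 := by
    simpa only [Φ_zero] using hasDerivWithinAt_lie (hΨ X) (hΨ Y)
  have second_deriv : 2 * iteratedDerivWithin 2 k J 0
      = (h 0).inner 1 (⁅X, Ψ Y⁆ + ⁅Ψ X, Y⁆) (⁅X, Ψ Y⁆ + ⁅Ψ X, Y⁆) := by
    rw [double_zero.iteratedDerivWithin_two]
    ring
  refine ⟨double_zero.contDiffWithinAt, double_zero.eq_zero, double_zero.derivWithin_eq_zero,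
    second_deriv, ⟨_, deriv_lie, second_deriv⟩, ?_⟩
  linarith [(h 0).inner_self_nonneg (⁅X, Ψ Y⁆ + ⁅Ψ X, Y⁆)]

end MetricPath

end

/-- `J` is the parameter interval of the path `h`; all derivatives in `t` are taken within `J`, so
that `0` may be an interior point or an endpoint. -/
theorem lemma1
    {E : Type*} [NormedAddCommGroup E] [NormedSpace ℝ E] [FiniteDimensional ℝ E]
    {H : Type*} [TopologicalSpace H] {I : ModelWithCorners ℝ E H} [I.Boundaryless]
    {G : Type*} [TopologicalSpace G] [ChartedSpace H G] [Group G] [LieGroup I ∞ G]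
    [CompactSpace G]
    (J : Set ℝ) (hJ : J.OrdConnected) (hJ_nontrivial : J.Nontrivial) (hJ_zero : (0 : ℝ) ∈ J)
    (h : ℝ → SmoothMetric I G)
    (h_left : ∀ t ∈ J, IsLeftInvariant (h t))
    (h_zero : IsBiInvariant (h 0))
    (h_smooth : ∀ A B : GroupLieAlgebra I G,
      ContDiffWithinAt ℝ 2 (fun t ↦ (h t).inner 1 A B) J 0)
    (Φ : ℝ → GroupLieAlgebra I G →ₗ[ℝ] GroupLieAlgebra I G)
    (hΦ : ∀ t ∈ J, ∀ A B : GroupLieAlgebra I G, (h t).inner 1 A B = (h 0).inner 1 (Φ t A) B)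
    (Ψ : GroupLieAlgebra I G →ₗ[ℝ] GroupLieAlgebra I G)
    (hΨ : ∀ A : GroupLieAlgebra I G, HasDerivWithinAt (fun t ↦ Φ t A) (Ψ A) J 0)
    (X Y : GroupLieAlgebra I G) (hXY : ⁅X, Y⁆ = 0)
    (k : ℝ → ℝ) (hk : ∀ t ∈ J, k t = lieSectionalCurvature (h t) X Y) :
    ContDiffWithinAt ℝ 2 k J 0 ∧
    k 0 = 0 ∧
    derivWithin k J 0 = 0 ∧
    2 * iteratedDerivWithin 2 k J 0
      = (h 0).inner 1 (⁅X, Ψ Y⁆ + ⁅Ψ X, Y⁆) (⁅X, Ψ Y⁆ + ⁅Ψ X, Y⁆) ∧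
    (∃ D : GroupLieAlgebra I G, HasDerivWithinAt (fun t ↦ ⁅Φ t X, Φ t Y⁆) D J 0 ∧
      2 * iteratedDerivWithin 2 k J 0 = (h 0).inner 1 D D) ∧
    0 ≤ iteratedDerivWithin 2 k J 0 :=
  lemma1_general (uniqueDiffOn_convex hJ.convex
    (hJ.convex.nontrivial_iff_nonempty_interior.1 hJ_nontrivial))
    hJ_zero h_left h_zero h_smooth hΦ hΨ hXY hk
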